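/- Let $\mathbb N=\{1,2,3,\dots\}$, let $a,b\in\mathbb R$ and let $V:\mathbb N\to\{a,b\}$. Let $H$ be the bounded self-adjoint operator on $\ell^2(\mathbb N)$ given by $$(H\psi)(n)=\psi(n-1)+\psi(n+1)+V(n)\psi(n)\quad(n\ge 1),\qquad \psi(0)=0 .$$ For $n\in\mathbb N$, $T>0$ and $p>0$ put $$a(n,T)=\frac1T\int_0^\infty e^{-2t/T}\,\bigl|\langle\delta_n,e^{-itH}\delta_1\rangle\bigr|^2\,dt,\qquad \beta^-_{\delta_1}(p)=\liminf_{T\to+\infty}\frac{\log\sum_{n\ge1} n^p\,a(n,T)}{\log T}.$$ Assume that, eventually, runs of the value $a$ have even length: there is $N\in\mathbb N$ such that, whenever $n\ge N$, $k\ge1$, $V(n)=V(n+k+1)=b$ and $V(n+j)=a$ for all $1\le j\le k$, the number $k$ is even. (a) If $|a-b|<2$, then $\beta^-_{\delta_1}(p)\ge p-1$ for every $p>0$. (b) If $|a-b|=2$, then $\beta^-_{\delta_1}(p)\ge\dfrac{p-5}{2}$ for every $p>0$. -/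

import Mathlib

open scoped ENNReal

noncomputable section

namespace HalfLine

/-- The Hilbert space of square-summable complex sequences indexed by the sites `1, 2, 3, …`. -/
abbrev ell2 : Type := lp (fun _ : ℕ+ => ℂ) 2

/-- The unit vector at site `n`. -/
def delta (n : ℕ+) : ell2 := lp.single 2 n (1 : ℂ)

/-- Extension of a sequence on the sites `1, 2, 3, …` to site `0` by the Dirichlet
boundary condition `ψ(0) = 0`. -/
def dirichletExt (ψ : ℕ+ → ℂ) : ℕ → ℂ
  | 0 => 0
  | n + 1 => ψ n.succPNat

/-- The discrete Schrödinger expression `ψ(n-1) + ψ(n+1) + V(n) ψ(n)` with Dirichlet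
boundary condition `ψ(0) = 0`. -/
def schrodingerFun (V : ℕ+ → ℝ) (ψ : ℕ+ → ℂ) (n : ℕ+) : ℂ :=
  dirichletExt ψ ((n : ℕ) - 1) + ψ (n + 1) + (V n : ℂ) * ψ n

lemma dirichletExt_add (ψ φ : ℕ+ → ℂ) (n : ℕ) :
    dirichletExt (ψ + φ) n = dirichletExt ψ n + dirichletExt φ n := by
  cases n <;> simp [dirichletExt]

lemma dirichletExt_smul (c : ℂ) (ψ : ℕ+ → ℂ) (n : ℕ) :
    dirichletExt (c • ψ) n = c * dirichletExt ψ n := by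
  cases n <;> simp [dirichletExt]

lemma schrodingerFun_add (V : ℕ+ → ℝ) (ψ φ : ℕ+ → ℂ) :
    schrodingerFun V (ψ + φ) = schrodingerFun V ψ + schrodingerFun V φ := by
  funext n
  simp only [schrodingerFun, dirichletExt_add, Pi.add_apply]
  ring

lemma schrodingerFun_smul (V : ℕ+ → ℝ) (c : ℂ) (ψ : ℕ+ → ℂ) :
    schrodingerFun V (c • ψ) = c • schrodingerFun V ψ := by
  funext n
  simp only [schrodingerFun, dirichletExt_smul, Pi.smul_apply, smul_eq_mul]
  ring

lemma memlp_shift {ψ : ℕ+ → ℂ} (h : Memℓp ψ 2) : Memℓp (fun n => ψ (n + 1)) 2 := by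
  rw [memℓp_gen_iff (by norm_num)] at h ⊢
  exact h.comp_injective (i := fun n : ℕ+ => n + 1) (fun _ _ hxy => add_right_cancel hxy)

lemma memlp_ext {ψ : ℕ+ → ℂ} (h : Memℓp ψ 2) :
    Memℓp (fun n : ℕ+ => dirichletExt ψ ((n : ℕ) - 1)) 2 := by
  rw [memℓp_gen_iff (by norm_num)] at h ⊢
  have e : (fun n : ℕ+ => ‖dirichletExt ψ ((n : ℕ) - 1)‖ ^ (2 : ℝ≥0∞).toReal)
      = (fun k : ℕ => ‖dirichletExt ψ k‖ ^ (2 : ℝ≥0∞).toReal) ∘ Equiv.pnatEquivNat := by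
    funext n
    simp [Equiv.pnatEquivNat, PNat.natPred]
  rw [e, Equiv.summable_iff, ← summable_nat_add_iff 1, ← Equiv.pnatEquivNat.summable_iff]
  refine h.congr fun n => ?_
  simp [Equiv.pnatEquivNat, dirichletExt]

lemma memlp_mul {V : ℕ+ → ℝ} (hV : ∃ C, ∀ n, |V n| ≤ C) {ψ : ℕ+ → ℂ} (h : Memℓp ψ 2) :
    Memℓp (fun n => (V n : ℂ) * ψ n) 2 := by
  obtain ⟨C, hC⟩ := hV
  rw [memℓp_gen_iff (by norm_num)] at h ⊢
  refine Summable.of_nonneg_of_le (fun n => by positivity) (fun n => ?_) (h.mul_left (C ^ 2))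
  simp only [ENNReal.toReal_ofNat, Real.rpow_ofNat, norm_mul, mul_pow, Complex.norm_real,
    Real.norm_eq_abs]
  gcongr
  exact hC n

lemma memlp_schrodinger {V : ℕ+ → ℝ} (hV : ∃ C, ∀ n, |V n| ≤ C) {ψ : ℕ+ → ℂ}
    (h : Memℓp ψ 2) : Memℓp (schrodingerFun V ψ) 2 :=
  ((memlp_ext h).add (memlp_shift h)).add (memlp_mul hV h)

/-- The Schrödinger operator with bounded potential `V`, as a linear map of `ell2`. -/
def schrodingerLin (V : ℕ+ → ℝ) (hV : ∃ C, ∀ n, |V n| ≤ C) : ell2 →ₗ[ℂ] ell2 where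
  toFun ψ := ⟨schrodingerFun V ψ, memlp_schrodinger hV (lp.memℓp ψ)⟩
  map_add' ψ φ := Subtype.ext (schrodingerFun_add V ψ φ)
  map_smul' c ψ := Subtype.ext (schrodingerFun_smul V c ψ)

lemma continuous_coord (n : ℕ+) : Continuous fun ψ : ell2 => ψ n :=
  (lp.evalCLM ℂ (fun _ : ℕ+ => ℂ) 2 n).continuous

lemma continuous_schrodingerLin (V : ℕ+ → ℝ) (hV : ∃ C, ∀ n, |V n| ≤ C) :
    Continuous (schrodingerLin V hV) := by
  refine LinearMap.continuous_of_seq_closed_graph _ fun u x y hu hy => ?_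
  apply Subtype.ext
  funext n
  have hc : Continuous fun ψ : ell2 => (schrodingerLin V hV ψ) n := by
    have h0 (m : ℕ) : Continuous fun ψ : ell2 => dirichletExt ψ m := by
      cases m with
      | zero => exact continuous_const
      | succ m => exact continuous_coord m.succPNat
    exact ((h0 _).add (continuous_coord (n + 1))).add
      (continuous_const.mul (continuous_coord n))
  exact tendsto_nhds_unique (((continuous_coord n).tendsto y).comp hy)
    ((hc.tendsto x).comp hu)

/-- The discrete Schrödinger operator
`(H ψ)(n) = ψ(n-1) + ψ(n+1) + V(n) ψ(n)`, `n ≥ 1`, `ψ(0) = 0`,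
with bounded real potential `V`, as a bounded operator on `ell2`. -/
def schrodinger (V : ℕ+ → ℝ) (hV : ∃ C, ∀ n, |V n| ≤ C) : ell2 →L[ℂ] ell2 :=
  ⟨schrodingerLin V hV, continuous_schrodingerLin V hV⟩

lemma schrodinger_apply (V : ℕ+ → ℝ) (hV : ∃ C, ∀ n, |V n| ≤ C) (ψ : ell2) (n : ℕ+) :
    schrodinger V hV ψ n =
      dirichletExt ψ ((n : ℕ) - 1) + ψ (n + 1) + (V n : ℂ) * ψ n := rfl

/-- The time evolution `ψ(t) = exp(-itH) ψ` (the exponential series of a bounded operator). -/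
def evolve (H : ell2 →L[ℂ] ell2) (ψ : ell2) (t : ℝ) : ell2 :=
  NormedSpace.exp ((-(Complex.I * (t : ℂ))) • H) ψ

/-- The time-averaged probability
`a(n,T) = (1/T) ∫₀^∞ e^{-2t/T} |⟨δ_n, exp(-itH) ψ⟩|² dt`. -/
def avgProb (H : ell2 →L[ℂ] ell2) (ψ : ell2) (n : ℕ+) (T : ℝ) : ℝ≥0∞ :=
  ENNReal.ofReal (1 / T) * ∫⁻ t in Set.Ioi (0 : ℝ),
    ENNReal.ofReal (Real.exp (-2 * t / T) * ‖inner ℂ (delta n) (evolve H ψ t)‖ ^ 2)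

/-- The time-averaged moment `∑ₙ n^p a(n,T)`, with values in `[0,∞]`. -/
def moment (H : ell2 →L[ℂ] ell2) (ψ : ell2) (p T : ℝ) : ℝ≥0∞ :=
  ∑' n : ℕ+, ENNReal.ofReal (((n : ℕ) : ℝ) ^ p) * avgProb H ψ n T

/-- The lower growth exponent
`β⁻_ψ(p) = liminf_{T → +∞} log (∑ₙ n^p a(n,T)) / log T`, as an extended real number. -/
def lowerExponent (H : ell2 →L[ℂ] ell2) (ψ : ell2) (p : ℝ) : EReal :=
  Filter.liminf (fun T : ℝ => ENNReal.log (moment H ψ p T) / ((Real.log T : ℝ) : EReal))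
    Filter.atTop

/-- For `n` large enough, a maximal run of `k ≥ 1` consecutive values `a` enclosed by two
values `b`, at sites `n` and `n + k + 1`, has even length `k`. -/
def EventuallyEvenRuns (a b : ℝ) (V : ℕ+ → ℝ) : Prop :=
  ∃ N : ℕ+, ∀ n : ℕ+, N ≤ n → ∀ k : ℕ+,
    V n = b → V (n + k + 1) = b → (∀ j : ℕ+, j ≤ k → V (n + j) = a) → Even (k : ℕ)

/-- A potential with two values is bounded. -/
lemma bounded_of_two_valued {a b : ℝ} {V : ℕ+ → ℝ} (hV : ∀ n, V n = a ∨ V n = b) :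
    ∃ C, ∀ n, |V n| ≤ C :=
  ⟨max |a| |b|, fun n => by rcases hV n with h | h <;> simp [h]⟩

end HalfLine

end

open scoped ENNReal

namespace HalfLine

open MeasureTheory Filter Topology

/-! Everything happens at the single energy `E = a`, where the coefficient `a - V n` is `0` or `a -
b`. The matrix `A = stepBack 0` squares to `-1`, so a run of `a` of even length contributes only a
sign. Beyond the site from which runs are even, every transfer product therefore collapses to `± A ^
s * B ^ q * A ^ t` with `B = stepBack (a - b)` (`stepProd_eq_of_even_runs`). Powers of `A` have norm
at most one, so only powers of `B` matter: they are bounded if `|a - b| < 2` and grow at most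
linearly if `|a - b| = 2`. Hence the products of length `m` are at most `C * (1 + m) ^ α`, with `α =
0` or `α = 1`.

Such a bound at one energy already forces transport (`le_lowerExponent_of_norm_stepProd_le`). The
Laplace transform `U` of the evolution of `δ₁` at `z = E + 2i/T` solves the difference equation with
value `i` at site `0`, and Cauchy–Schwarz in time gives `a(n,T) ≥ (2/T²)|U(n)|²`. Moving the energy
from `E` to `z` is harmless up to sites of order `x = T ^ (1/(1+α))`, so on each neighbouring pair
there `|U|` is at least of order `x ^ (-α)`. About `x` such pairs, each with weight of order `x ^
p`, give a moment of order at least `x ^ (p+1-2α) / T²`, which is `T ^ ((p-1-4α)/(1+α))`. -/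

/-! ### One-step matrices and their products -/

/-- The inverse one-step transfer matrix `(x, y) ↦ (y, c y - x)` on `ℂ × ℂ`. -/
noncomputable def stepBack (c : ℂ) : (ℂ × ℂ) →L[ℂ] (ℂ × ℂ) :=
  (ContinuousLinearMap.snd ℂ ℂ ℂ).prod
    (c • ContinuousLinearMap.snd ℂ ℂ ℂ - ContinuousLinearMap.fst ℂ ℂ ℂ)

@[simp] lemma stepBack_apply (c : ℂ) (w : ℂ × ℂ) : stepBack c w = (w.2, c * w.2 - w.1) := rfl

lemma clm_mul_smul (s : ℂ) (f g : ℂ × ℂ →L[ℂ] ℂ × ℂ) : f * s • g = s • (f * g) :=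
  Algebra.mul_smul_comm s f g

lemma clm_neg_mul (f g : ℂ × ℂ →L[ℂ] ℂ × ℂ) : -f * g = -(f * g) := neg_mul f g

lemma clm_mul_neg (f g : ℂ × ℂ →L[ℂ] ℂ × ℂ) : f * -g = -(f * g) := mul_neg f g

/-- The product of the one-step matrices with coefficients `c j, …, c (j + m - 1)`. -/
noncomputable def stepProd (c : ℕ → ℂ) (j : ℕ) : ℕ → ((ℂ × ℂ) →L[ℂ] (ℂ × ℂ))
  | 0 => 1
  | m + 1 => stepProd c j m * stepBack (c (j + m))

lemma norm_stepBack_apply_le (c : ℂ) (w : ℂ × ℂ) : ‖stepBack c w‖ ≤ (1 + ‖c‖) * ‖w‖ := by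
  have h1 := norm_fst_le w
  have h2 := norm_snd_le w
  have h3 : ‖c‖ * ‖w.2‖ ≤ ‖c‖ * ‖w‖ := by gcongr
  have h4 : ‖c * w.2 - w.1‖ ≤ ‖c‖ * ‖w.2‖ + ‖w.1‖ := by
    simpa using norm_sub_le (c * w.2) w.1
  have h5 : 0 ≤ ‖c‖ * ‖w‖ := by positivity
  rw [stepBack_apply, Prod.norm_def]
  exact max_le (by simp only; linarith) (by simp only; linarith)

lemma stepBack_zero_sq : stepBack 0 * stepBack 0 = -1 := by
  ext <;> simp

lemma norm_stepBack_zero_pow_le (k : ℕ) : ‖stepBack 0 ^ k‖ ≤ 1 := by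
  have h : ‖stepBack 0‖ ≤ 1 :=
    ContinuousLinearMap.opNorm_le_bound _ zero_le_one fun w => by
      simpa using norm_stepBack_apply_le 0 w
  rcases Nat.eq_zero_or_pos k with rfl | hk
  · simp
  · exact (norm_pow_le' _ hk).trans (pow_le_one₀ (norm_nonneg _) h)

lemma stepBack_zero_pow_even {k : ℕ} (hk : Even k) :
    stepBack 0 ^ k = 1 ∨ stepBack 0 ^ k = -1 := by
  obtain ⟨r, rfl⟩ := hk
  rw [← two_mul, pow_mul, pow_two, stepBack_zero_sq]
  exact neg_one_pow_eq_or (ℂ × ℂ →L[ℂ] ℂ × ℂ) r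

/-- The invariant quadratic form of `stepBack c` for real `c`. -/
lemma stepBack_form (c : ℝ) (w : ℂ × ℂ) :
    ‖(stepBack c w).1‖ ^ 2 + ‖(stepBack c w).2‖ ^ 2
        - c * ((stepBack c w).1.re * (stepBack c w).2.re
          + (stepBack c w).1.im * (stepBack c w).2.im)
      = ‖w.1‖ ^ 2 + ‖w.2‖ ^ 2 - c * (w.1.re * w.2.re + w.1.im * w.2.im) := by
  simp only [stepBack_apply, Complex.sq_norm, Complex.normSq_apply, Complex.sub_re,
    Complex.sub_im, Complex.re_ofReal_mul, Complex.im_ofReal_mul]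
  ring

lemma stepBack_pow_form (c : ℝ) (w : ℂ × ℂ) (m : ℕ) :
    ‖((stepBack c ^ m) w).1‖ ^ 2 + ‖((stepBack c ^ m) w).2‖ ^ 2
        - c * (((stepBack c ^ m) w).1.re * ((stepBack c ^ m) w).2.re
          + ((stepBack c ^ m) w).1.im * ((stepBack c ^ m) w).2.im)
      = ‖w.1‖ ^ 2 + ‖w.2‖ ^ 2 - c * (w.1.re * w.2.re + w.1.im * w.2.im) := by
  induction m with
  | zero => simp
  | succ m ih =>
    have e : (stepBack c ^ (m + 1)) w = stepBack c ((stepBack c ^ m) w) := by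
      rw [pow_succ' (stepBack (c : ℂ))]; rfl
    rw [← ih, e]
    exact stepBack_form c _

lemma abs_re_mul_add_im_mul_le (x y : ℂ) :
    |x.re * y.re + x.im * y.im| ≤ (‖x‖ ^ 2 + ‖y‖ ^ 2) / 2 := by
  simp only [Complex.sq_norm, Complex.normSq_apply]
  rw [abs_le]
  constructor
  · nlinarith [sq_nonneg (x.re + y.re), sq_nonneg (x.im + y.im)]
  · nlinarith [sq_nonneg (x.re - y.re), sq_nonneg (x.im - y.im)]

/-- The invariant quadratic form is positive definite for `|c| < 2`: it lies between `1 - |c|/2` and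
`2` times `‖x‖² + ‖y‖²`. The `4` is this `2` times another `2`, since the norm on `ℂ × ℂ` is the
maximum. -/
lemma norm_stepBack_pow_le_of_elliptic {c : ℝ} (hc : |c| < 2) :
    ∃ C : ℝ, ∀ m : ℕ, ‖stepBack c ^ m‖ ≤ C := by
  set d : ℝ := 1 - |c| / 2 with hd
  have hd0 : 0 < d := by rw [hd]; linarith
  refine ⟨Real.sqrt (4 / d), fun m =>
    ContinuousLinearMap.opNorm_le_bound _ (Real.sqrt_nonneg _) fun w => ?_⟩
  have key := stepBack_pow_form c w m
  set v := (stepBack (c : ℂ) ^ m) w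
  have bound (x y : ℂ) : |c * (x.re * y.re + x.im * y.im)|
      ≤ |c| / 2 * (‖x‖ ^ 2 + ‖y‖ ^ 2) := by
    rw [abs_mul]
    calc _ ≤ |c| * ((‖x‖ ^ 2 + ‖y‖ ^ 2) / 2) := by gcongr; exact abs_re_mul_add_im_mul_le x y
      _ = _ := by ring
  have h1 := (abs_le.1 (bound v.1 v.2)).2
  have h2 := (abs_le.1 (bound w.1 w.2)).1
  have h3 : ‖w.1‖ ^ 2 ≤ ‖w‖ ^ 2 := by gcongr; exact norm_fst_le w
  have h4 : ‖w.2‖ ^ 2 ≤ ‖w‖ ^ 2 := by gcongr; exact norm_snd_le w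
  have h5 : d * (‖v.1‖ ^ 2 + ‖v.2‖ ^ 2) ≤ 4 * ‖w‖ ^ 2 := by
    have : |c| / 2 * (‖w.1‖ ^ 2 + ‖w.2‖ ^ 2) ≤ 1 * (‖w.1‖ ^ 2 + ‖w.2‖ ^ 2) := by
      gcongr; linarith
    rw [hd]; nlinarith
  have h6 : ‖v.1‖ ^ 2 + ‖v.2‖ ^ 2 ≤ 4 / d * ‖w‖ ^ 2 := by
    rw [div_mul_eq_mul_div, le_div_iff₀ hd0]; linarith
  have h7 : Real.sqrt (4 / d) * ‖w‖ = Real.sqrt (4 / d * ‖w‖ ^ 2) := by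
    rw [Real.sqrt_mul (by positivity), Real.sqrt_sq (norm_nonneg _)]
  rw [h7, Prod.norm_def]
  exact max_le (Real.le_sqrt_of_sq_le (by nlinarith [sq_nonneg ‖v.2‖]))
    (Real.le_sqrt_of_sq_le (by nlinarith [sq_nonneg ‖v.1‖]))

/-- Here `c = 2s` with `s = ±1`, and `s` is a double eigenvalue: `(B - s)² = 0`. Each further power
thus adds a term of constant norm `‖B - s‖`. -/
lemma norm_stepBack_pow_le_of_parabolic {c : ℝ} (hc : |c| = 2) :
    ∃ C : ℝ, 0 ≤ C ∧ ∀ m : ℕ, ‖stepBack c ^ m‖ ≤ 1 + C * m := by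
  obtain ⟨s, hs, rfl⟩ : ∃ s : ℝ, |s| = 1 ∧ c = 2 * s :=
    ⟨c / 2, by rw [abs_div, hc]; norm_num, by ring⟩
  have hss : (s : ℂ) * s = 1 := by
    have : s * s = 1 := by rw [← abs_mul_abs_self, hs, one_mul]
    exact_mod_cast this
  set B := stepBack ((2 * s : ℝ) : ℂ) with hB
  have hnil : B * (B - (s : ℂ) • 1) = (s : ℂ) • (B - (s : ℂ) • 1) := by
    ext <;> simp [hB]
    all_goals first | ring1 | linear_combination -hss | linear_combination hss
  have hpow (m : ℕ) : ‖B ^ m * (B - (s : ℂ) • 1)‖ = ‖B - (s : ℂ) • 1‖ := by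
    induction m with
    | zero => simp
    | succ m ih => rw [pow_succ, mul_assoc, hnil, clm_mul_smul, norm_smul, ih]; simp [hs]
  refine ⟨‖B - (s : ℂ) • 1‖, norm_nonneg _, fun m => ?_⟩
  induction m with
  | zero => simp
  | succ m ih =>
    have e : B ^ (m + 1) = B ^ m * (B - (s : ℂ) • 1) + (s : ℂ) • B ^ m := by
      rw [pow_succ, mul_sub, clm_mul_smul, mul_one]; abel
    calc ‖B ^ (m + 1)‖ ≤ ‖B ^ m * (B - (s : ℂ) • 1)‖ + ‖(s : ℂ) • B ^ m‖ := by
          rw [e]; exact norm_add_le _ _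
      _ = ‖B - (s : ℂ) • 1‖ + ‖B ^ m‖ := by rw [hpow, norm_smul]; simp [hs]
      _ ≤ _ := by push_cast; linarith

/-- With even runs of zeros, a product of one-step matrices collapses to
`± A ^ s * B ^ q * A ^ t` with `A = stepBack 0` and `B = stepBack d`. -/
lemma stepProd_eq_of_even_runs {c : ℕ → ℂ} {d : ℂ} {N : ℕ} (hc : ∀ n, c n = 0 ∨ c n = d)
    (heven : ∀ n ≥ N, ∀ k ≥ 1, c n = d → c (n + k + 1) = d →
      (∀ i, 1 ≤ i → i ≤ k → c (n + i) = 0) → Even k) {j : ℕ} (hj : N ≤ j) (m : ℕ) :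
    stepProd c j m = stepBack 0 ^ m ∨
    ∃ l t s q : ℕ, l + 1 + t = m ∧ c (j + l) = d ∧
      (∀ i, 1 ≤ i → i ≤ t → c (j + l + i) = 0) ∧ q ≤ m ∧
      (stepProd c j m = stepBack 0 ^ s * stepBack d ^ q * stepBack 0 ^ t ∨
        stepProd c j m = -(stepBack 0 ^ s * stepBack d ^ q * stepBack 0 ^ t)) := by
  induction m with
  | zero => left; simp [stepProd]
  | succ m ih =>
    rcases hc (j + m) with h0 | hd
    · rcases ih with ih | ⟨l, t, s, q, hm, hl, hz, hq, ih⟩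
      · left; rw [stepProd, ih, h0, pow_succ]
      · right
        refine ⟨l, t + 1, s, q, by omega, hl, fun i hi hit => ?_, by omega, ?_⟩
        · rcases Nat.lt_or_ge i (t + 1) with h | h
          · exact hz i hi (by omega)
          · rw [show j + l + i = j + m by omega, h0]
        · rw [stepProd, h0, pow_succ]
          rcases ih with ih | ih
          · left; rw [ih, mul_assoc]
          · right; rw [ih, clm_neg_mul, mul_assoc]
    · right
      rcases ih with ih | ⟨l, t, s, q, hm, hl, hz, hq, ih⟩
      · refine ⟨m, 0, m, 1, by omega, hd, fun i hi hi' => by omega, by omega, Or.inl ?_⟩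
        rw [stepProd, ih, hd]; simp
      · refine ⟨m, 0, s, q + 1, by omega, hd, fun i hi hi' => by omega, by omega, ?_⟩
        -- The trailing zeros now lie between two values `d`, so their number is even and `A ^ t =
        -- ±1`. Zeros before the first `d` or after the last one need no parity.
        have ht : Even t := by
          rcases Nat.eq_zero_or_pos t with rfl | ht
          · simp
          · exact heven (j + l) (by omega) t ht hl
              (by rw [show j + l + t + 1 = j + m by omega, hd]) hz
        rw [stepProd, hd, pow_zero, mul_one, pow_succ, ← mul_assoc]
        rcases stepBack_zero_pow_even ht with h | h <;> rcases ih with ih | ih <;>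
          rw [ih, h] <;> simp [clm_neg_mul, clm_mul_neg]

lemma norm_stepProd_le_of_even_runs {c : ℕ → ℂ} {d : ℂ} {N : ℕ}
    (hc : ∀ n, c n = 0 ∨ c n = d)
    (heven : ∀ n ≥ N, ∀ k ≥ 1, c n = d → c (n + k + 1) = d →
      (∀ i, 1 ≤ i → i ≤ k → c (n + i) = 0) → Even k) {j : ℕ} (hj : N ≤ j) (m : ℕ) :
    ∃ q ≤ m, ‖stepProd c j m‖ ≤ ‖stepBack d ^ q‖ := by
  have hA := norm_stepBack_zero_pow_le
  rcases stepProd_eq_of_even_runs hc heven hj m with h | ⟨l, t, s, q, -, -, -, hq, h⟩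
  · exact ⟨0, Nat.zero_le _, by rw [h]; simpa using hA m⟩
  · refine ⟨q, hq, ?_⟩
    have : ‖stepProd c j m‖ = ‖stepBack 0 ^ s * stepBack d ^ q * stepBack 0 ^ t‖ := by
      rcases h with h | h <;> rw [h]
      rw [norm_neg]
    rw [this]
    calc _ ≤ ‖stepBack 0 ^ s‖ * ‖stepBack d ^ q‖ * ‖stepBack 0 ^ t‖ :=
          (norm_mul_le _ _).trans (by gcongr; exact norm_mul_le _ _)
      _ ≤ 1 * ‖stepBack d ^ q‖ * 1 := by gcongr <;> apply hA
      _ = _ := by ring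

/-! ### Perturbation in the energy -/

/-- Discrete Duhamel formula: changing the coefficient by `η` adds `η • (0, w.2)` at each step. -/
lemma eq_stepProd_add_sum {c : ℕ → ℂ} {η : ℂ} {w : ℕ → ℂ × ℂ}
    (hw : ∀ k, w k = stepBack (c k + η) (w (k + 1))) (j m : ℕ) :
    w j = stepProd c j m (w (j + m)) +
      η • ∑ i ∈ Finset.range m, stepProd c j i (0, (w (j + i + 1)).2) := by
  induction m with
  | zero => simp [stepProd]
  | succ m ih =>
    have e : w (j + m) = stepBack (c (j + m)) (w (j + m + 1))
        + η • (0, (w (j + m + 1)).2) := by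
      rw [hw (j + m)]
      ext <;> simp
      ring
    rw [Finset.sum_range_succ, smul_add]
    nth_rewrite 1 [ih]
    nth_rewrite 1 [e]
    rw [map_add, map_smul]
    simp only [stepProd, mul_apply_eq_comp, ← add_assoc]
    abel

lemma norm_le_of_perturbation {c : ℕ → ℂ} {η : ℂ} {w : ℕ → ℂ × ℂ}
    (hw : ∀ k, w k = stepBack (c k + η) (w (k + 1))) {N n : ℕ} (hn : N ≤ n) {K : ℝ}
    (hK : ∀ j ≥ N, ∀ m, j + m ≤ n → ‖stepProd c j m‖ ≤ K) (hη : ‖η‖ * (n * K) ≤ 1 / 2) :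
    ‖w N‖ ≤ 2 * K * ‖w n‖ := by
  -- Starting Duhamel at a site of maximal norm bounds the error sum by half of that same maximum,
  -- which is then absorbed on the left.
  obtain ⟨j, hj, hmax⟩ := Finset.exists_max_image (Finset.Icc N n) (fun k => ‖w k‖)
    ⟨N, by simp [hn]⟩
  obtain ⟨hj1, hj2⟩ := Finset.mem_Icc.1 hj
  have hK0 : 0 ≤ K := (norm_nonneg _).trans (hK N le_rfl 0 (by omega))
  obtain ⟨m, rfl⟩ := Nat.exists_eq_add_of_le hj2
  have hsum : ‖∑ i ∈ Finset.range m, stepProd c j i (0, (w (j + i + 1)).2)‖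
      ≤ m * (K * ‖w j‖) := by
    refine (norm_sum_le_of_le (f := fun i => stepProd c j i (0, (w (j + i + 1)).2)) _
      (n := fun _ => K * ‖w j‖) fun i hi => ?_).trans (by simp)
    have hi := Finset.mem_range.1 hi
    refine (ContinuousLinearMap.le_opNorm _ _).trans ?_
    gcongr
    · exact hK j hj1 i (by omega)
    · have : ‖((0 : ℂ), (w (j + i + 1)).2)‖ ≤ ‖w (j + i + 1)‖ := by
        rw [Prod.norm_def]; simpa using norm_snd_le _
      exact this.trans (hmax _ (Finset.mem_Icc.2 ⟨by omega, by omega⟩))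
  have h1 : ‖w j‖ ≤ K * ‖w (j + m)‖ + ‖η‖ * (m * (K * ‖w j‖)) := by
    conv_lhs => rw [eq_stepProd_add_sum hw j m]
    refine (norm_add_le _ _).trans (add_le_add ?_ ?_)
    · refine (ContinuousLinearMap.le_opNorm _ _).trans ?_
      gcongr
      exact hK j hj1 m le_rfl
    · rw [norm_smul]; gcongr
  have h2 : ‖η‖ * (m * (K * ‖w j‖)) ≤ 1 / 2 * ‖w j‖ := by
    calc _ = ‖η‖ * (m * K) * ‖w j‖ := by ring
      _ ≤ ‖η‖ * ((j + m : ℕ) * K) * ‖w j‖ := by gcongr; omega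
      _ ≤ _ := by gcongr
  have h3 := hmax N (by simp [hn])
  linarith

/-- Crude bound for the finitely many initial sites, where no parity is available; it costs only a
constant independent of `T`. -/
lemma norm_zero_le_pow_mul {c : ℕ → ℂ} {w : ℕ → ℂ × ℂ}
    (hw : ∀ k, w k = stepBack (c k) (w (k + 1))) {D : ℝ} (hD : ∀ k, 1 + ‖c k‖ ≤ D) (n : ℕ) :
    ‖w 0‖ ≤ D ^ n * ‖w n‖ := by
  have hD0 : 0 ≤ D := le_trans (by positivity) (hD 0)
  induction n with
  | zero => simp
  | succ n ih =>
    calc ‖w 0‖ ≤ D ^ n * ‖w n‖ := ih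
      _ ≤ D ^ n * (D * ‖w (n + 1)‖) := by
          gcongr
          rw [hw n]
          exact (norm_stepBack_apply_le _ _).trans (by gcongr; exact hD n)
      _ = _ := by ring

/-! ### Self-adjointness and the time evolution -/

/-- The two shifts are adjoint because the boundary condition kills the only unmatched term, at site
`1`. -/
lemma inner_dirichletExt_eq_inner_shift (x y : ell2) :
    inner ℂ (⟨_, memlp_ext (lp.memℓp x)⟩ : ell2) y =
      inner ℂ x (⟨_, memlp_shift (lp.memℓp y)⟩ : ell2) := by
  rw [← (lp.hasSum_inner _ y).tsum_eq, ← (lp.hasSum_inner x _).tsum_eq]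
  have hinj : Function.Injective fun n : ℕ+ => n + 1 := fun _ _ h => add_right_cancel h
  refine (hinj.tsum_eq (f := fun n : ℕ+ =>
    inner ℂ (dirichletExt x ((n : ℕ) - 1)) (y n)) fun n hn => ?_).symm.trans
    (tsum_congr fun n => ?_)
  swap
  · obtain ⟨k, rfl⟩ := (⟨n.natPred, n.succPNat_natPred⟩ : ∃ k : ℕ, k.succPNat = n)
    rfl
  rcases eq_or_ne n 1 with rfl | h1
  · exact absurd (by simp [dirichletExt]) hn
  · obtain ⟨k, rfl⟩ := PNat.exists_eq_succ_of_ne_one h1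
    exact ⟨k, rfl⟩

lemma isSelfAdjoint_schrodinger (V : ℕ+ → ℝ) (hV : ∃ C, ∀ n, |V n| ≤ C) :
    IsSelfAdjoint (schrodinger V hV) := by
  rw [ContinuousLinearMap.isSelfAdjoint_iff_isSymmetric]
  intro x y
  have e (ψ : ell2) : schrodinger V hV ψ = (⟨_, memlp_ext (lp.memℓp ψ)⟩ : ell2)
      + (⟨_, memlp_shift (lp.memℓp ψ)⟩ : ell2) + (⟨_, memlp_mul hV (lp.memℓp ψ)⟩ : ell2) := rfl
  have hmul : inner ℂ (⟨_, memlp_mul hV (lp.memℓp x)⟩ : ell2) y =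
      inner ℂ x (⟨_, memlp_mul hV (lp.memℓp y)⟩ : ell2) := by
    rw [← (lp.hasSum_inner _ y).tsum_eq, ← (lp.hasSum_inner x _).tsum_eq]
    refine tsum_congr fun n => ?_
    simp only [RCLike.inner_apply, map_mul, Complex.conj_ofReal]
    ring
  have hshift : inner ℂ (⟨_, memlp_shift (lp.memℓp x)⟩ : ell2) y =
      inner ℂ x (⟨_, memlp_ext (lp.memℓp y)⟩ : ell2) := by
    rw [← inner_conj_symm, ← inner_dirichletExt_eq_inner_shift, inner_conj_symm]
  change inner ℂ (schrodinger V hV x) y = inner ℂ x (schrodinger V hV y)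
  rw [e x, e y, inner_add_left, inner_add_left, inner_add_right, inner_add_right,
    inner_dirichletExt_eq_inner_shift, hshift, hmul]
  ring

lemma inner_delta (n : ℕ+) (ψ : ell2) : inner ℂ (delta n) ψ = ψ n := by
  rw [delta, lp.inner_single_left]; simp

lemma evolve_zero (H : ell2 →L[ℂ] ell2) (ψ : ell2) : evolve H ψ 0 = ψ := by
  simp [evolve]

lemma hasDerivAt_evolve (H : ell2 →L[ℂ] ell2) (ψ : ell2) (t : ℝ) :
    HasDerivAt (evolve H ψ) (-Complex.I • H (evolve H ψ t)) t := by
  have h := hasDerivAt_exp_smul_const' (𝕂 := ℂ) H (-(Complex.I * (t : ℂ)))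
  have h1 : HasDerivAt (fun s : ℝ => -(Complex.I * (s : ℂ))) (-Complex.I) t := by
    simpa using ((hasDerivAt_id t).ofReal_comp.const_mul Complex.I).fun_neg
  have h2 := ((ContinuousLinearMap.apply ℂ ell2 ψ).restrictScalars ℝ).hasFDerivAt.comp_hasDerivAt t
    (h.scomp t h1)
  exact h2

lemma norm_evolve {H : ell2 →L[ℂ] ell2} (hH : IsSelfAdjoint H) (ψ : ell2) (t : ℝ) :
    ‖evolve H ψ t‖ = ‖ψ‖ := by
  have hs : IsSelfAdjoint ((-(t : ℂ)) • H) :=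
    .smul (by simp [isSelfAdjoint_iff]) hH
  have e : evolve H ψ t =
      ((selfAdjoint.expUnitary ⟨_, hs⟩ : unitary (ell2 →L[ℂ] ell2)) : ell2 →L[ℂ] ell2) ψ := by
    have : (-(Complex.I * (t : ℂ))) • H = Complex.I • (-(t : ℂ)) • H := by
      rw [show -(Complex.I * (t : ℂ)) = Complex.I * -(t : ℂ) by ring]
      exact mul_smul _ _ _
    rw [evolve, this]
    rfl
  rw [e]
  exact Unitary.norm_map _ ψ

/-! ### The Laplace transform of the evolution -/

/-- The Laplace transform `∫₀^∞ exp(izt) exp(-itH) ψ dt`. -/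
noncomputable def laplace (H : ell2 →L[ℂ] ell2) (ψ : ell2) (z : ℂ) : ell2 :=
  ∫ t in Set.Ioi (0 : ℝ), Complex.exp (Complex.I * z * t) • evolve H ψ t

lemma norm_exp_I_mul (z : ℂ) (t : ℝ) :
    ‖Complex.exp (Complex.I * z * t)‖ = Real.exp (-z.im * t) := by
  rw [Complex.norm_exp]; simp

lemma continuous_evolve (H : ell2 →L[ℂ] ell2) (ψ : ell2) : Continuous (evolve H ψ) :=
  continuous_iff_continuousAt.2 fun t => (hasDerivAt_evolve H ψ t).continuousAt

lemma integrableOn_laplace {H : ell2 →L[ℂ] ell2} (hH : IsSelfAdjoint H) (ψ : ell2) {z : ℂ}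
    (hz : 0 < z.im) :
    IntegrableOn (fun t : ℝ => Complex.exp (Complex.I * z * t) • evolve H ψ t)
      (Set.Ioi 0) := by
  refine ((integrableOn_exp_mul_Ioi (neg_lt_zero.2 hz) 0).mul_const ‖ψ‖).mono' ?_ ?_
  · have := continuous_evolve H ψ
    exact (by fun_prop : Continuous fun t : ℝ =>
      Complex.exp (Complex.I * z * t) • evolve H ψ t).aestronglyMeasurable
  · filter_upwards with t
    rw [norm_smul, norm_exp_I_mul, norm_evolve hH]

lemma apply_laplace {H : ell2 →L[ℂ] ell2} (hH : IsSelfAdjoint H) (ψ : ell2) {z : ℂ}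
    (hz : 0 < z.im) : H (laplace H ψ z) = z • laplace H ψ z - Complex.I • ψ := by
  have hint := integrableOn_laplace hH ψ hz
  set f : ℝ → ell2 := fun t => Complex.exp (Complex.I * z * t) • evolve H ψ t with hf
  -- The integrand solves `f' = L f` with `L = i(z - H)` and decays, so integrating over the
  -- half-line gives `L U = -ψ`.
  let L : ell2 →L[ℂ] ell2 := (Complex.I * z) • (1 : ell2 →L[ℂ] ell2) - Complex.I • H
  have hderiv (t : ℝ) : HasDerivAt f (L (f t)) t := by
    have h1 : HasDerivAt (fun t : ℝ => Complex.exp (Complex.I * z * t))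
        (Complex.exp (Complex.I * z * t) * (Complex.I * z)) t := by
      have := ((hasDerivAt_id t).ofReal_comp.const_mul (Complex.I * z)).cexp
      simpa using this
    have h2 := h1.smul (hasDerivAt_evolve H ψ t)
    refine h2.congr_deriv ?_
    simp only [L, hf, sub_apply, smul_apply, map_smul, one_apply_eq_self]
    module
  have hlim : Tendsto f atTop (𝓝 0) := by
    rw [tendsto_zero_iff_norm_tendsto_zero]
    have : Tendsto (fun t : ℝ => Real.exp (-z.im * t) * ‖ψ‖) atTop (𝓝 (0 * ‖ψ‖)) :=
      (Real.tendsto_exp_atBot.comp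
        (tendsto_id.const_mul_atTop_of_neg (neg_lt_zero.2 hz))).mul_const _
    rw [zero_mul] at this
    refine this.congr fun t => ?_
    rw [hf, norm_smul, norm_exp_I_mul, norm_evolve hH]
  have h := integral_Ioi_of_hasDerivAt_of_tendsto' (a := 0) (fun t _ => hderiv t)
    (L.integrable_comp hint) hlim
  rw [L.integral_comp_comm hint] at h
  have h0 : f 0 = ψ := by simp [hf, evolve_zero]
  change L (laplace H ψ z) = 0 - f 0 at h
  rw [h0] at h
  have h3 : Complex.I • L (laplace H ψ z) = Complex.I • (0 - ψ) := by rw [h]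
  simp only [L, sub_apply, smul_apply,
      one_apply_eq_self, smul_sub, smul_smul, ← mul_assoc, Complex.I_mul_I,
      neg_mul, one_mul, neg_smul, one_smul, smul_zero] at h3
  have h4 : H (laplace H ψ z) =
      z • laplace H ψ z + (-(z • laplace H ψ z) - -H (laplace H ψ z)) := by
    abel
  rw [h4, h3]
  abel

/-- A weighted Cauchy–Schwarz inequality with exponential weight. -/
lemma sq_integral_exp_mul_le {ε : ℝ} (hε : 0 < ε) {g : ℝ → ℝ}
    (hg : IntegrableOn (fun t => Real.exp (-ε * t) * g t) (Set.Ioi 0))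
    (hg2 : IntegrableOn (fun t => Real.exp (-ε * t) * g t ^ 2) (Set.Ioi 0)) :
    ε * (∫ t in Set.Ioi (0 : ℝ), Real.exp (-ε * t) * g t) ^ 2 ≤
      ∫ t in Set.Ioi (0 : ℝ), Real.exp (-ε * t) * g t ^ 2 := by
  set X := ∫ t in Set.Ioi (0 : ℝ), Real.exp (-ε * t) * g t with hX
  set Y := ∫ t in Set.Ioi (0 : ℝ), Real.exp (-ε * t) * g t ^ 2 with hY
  have hexp := integrableOn_exp_mul_Ioi (neg_lt_zero.2 hε) 0
  -- Nonnegativity of a variance: `ε * X` is the mean of `g` for the probability density `ε * exp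
  -- (-ε t)`.
  have h0 : 0 ≤ ∫ t in Set.Ioi (0 : ℝ), Real.exp (-ε * t) * (g t - ε * X) ^ 2 :=
    integral_nonneg fun t => by positivity
  have e : (fun t => Real.exp (-ε * t) * (g t - ε * X) ^ 2) = fun t =>
      Real.exp (-ε * t) * g t ^ 2 - 2 * ε * X * (Real.exp (-ε * t) * g t)
        + (ε * X) ^ 2 * Real.exp (-ε * t) := by
    funext t; ring
  have hsub : IntegrableOn (fun t => Real.exp (-ε * t) * g t ^ 2
      - 2 * ε * X * (Real.exp (-ε * t) * g t)) (Set.Ioi 0) := hg2.sub (hg.const_mul _)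
  rw [e, integral_add hsub (hexp.const_mul _),
    integral_sub hg2 (hg.const_mul _), integral_const_mul, integral_const_mul,
    integral_exp_mul_Ioi (neg_lt_zero.2 hε), ← hX, ← hY] at h0
  have e2 : (ε * X) ^ 2 * (-Real.exp (-ε * 0) / -ε) = ε * X ^ 2 := by
    simp; field_simp
  rw [e2] at h0
  linarith

/-- With imaginary part `2/T` the Laplace kernel has modulus `exp (-2t/T)`, exactly the weight in
`avgProb`, so Cauchy–Schwarz applies at each fixed energy and no integral over energies is needed.
-/
lemma ofReal_laplace_le_avgProb {H : ell2 →L[ℂ] ell2} (hH : IsSelfAdjoint H) (ψ : ell2)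
    (n : ℕ+) {T E : ℝ} (hT : 0 < T) :
    ENNReal.ofReal (2 / T ^ 2 * ‖laplace H ψ (E + (2 / T : ℝ) * Complex.I) n‖ ^ 2) ≤
      avgProb H ψ n T := by
  set z : ℂ := E + (2 / T : ℝ) * Complex.I with hz
  have hzim : z.im = 2 / T := by simp [hz]
  have hε : 0 < 2 / T := by positivity
  have hzpos : 0 < z.im := by rw [hzim]; exact hε
  have hbd (t : ℝ) : ‖evolve H ψ t n‖ ≤ ‖ψ‖ := by
    rw [← norm_evolve hH ψ t]; exact lp.norm_apply_le_norm (by norm_num) _ _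
  have hcont : Continuous fun t => ‖evolve H ψ t n‖ :=
    ((continuous_coord n).comp (continuous_evolve H ψ)).norm
  have hexp := integrableOn_exp_mul_Ioi (neg_lt_zero.2 hε) 0
  have hg : IntegrableOn (fun t => Real.exp (-(2 / T) * t) * ‖evolve H ψ t n‖) (Set.Ioi 0) := by
    refine (hexp.mul_const ‖ψ‖).mono' (by fun_prop) ?_
    filter_upwards with t
    rw [Real.norm_of_nonneg (by positivity)]
    gcongr
    exact hbd t
  have hg2 : IntegrableOn (fun t => Real.exp (-(2 / T) * t) * ‖evolve H ψ t n‖ ^ 2)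
      (Set.Ioi 0) := by
    refine (hexp.mul_const (‖ψ‖ ^ 2)).mono' (by fun_prop) ?_
    filter_upwards with t
    rw [Real.norm_of_nonneg (by positivity)]
    gcongr
    exact hbd t
  have hnorm : ‖laplace H ψ z n‖ ≤
      ∫ t in Set.Ioi (0 : ℝ), Real.exp (-(2 / T) * t) * ‖evolve H ψ t n‖ := by
    have := (lp.evalCLM ℂ (fun _ : ℕ+ => ℂ) 2 n).integral_comp_comm
      (integrableOn_laplace hH ψ hzpos)
    change _ = laplace H ψ z n at this
    rw [← this]
    refine (norm_integral_le_integral_norm _).trans (le_of_eq ?_)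
    refine integral_congr_ae ?_
    filter_upwards with t
    rw [map_smul, norm_smul, norm_exp_I_mul, hzim]
    rfl
  have hcs := sq_integral_exp_mul_le hε hg hg2
  have key : 2 / T ^ 2 * ‖laplace H ψ z n‖ ^ 2 ≤
      1 / T * ∫ t in Set.Ioi (0 : ℝ), Real.exp (-(2 / T) * t) * ‖evolve H ψ t n‖ ^ 2 := by
    calc _ = 1 / T * (2 / T * ‖laplace H ψ z n‖ ^ 2) := by field_simp
      _ ≤ _ := by
        gcongr
        refine le_trans ?_ hcs
        gcongr
  refine (ENNReal.ofReal_le_ofReal key).trans (le_of_eq ?_)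
  rw [ENNReal.ofReal_mul (by positivity), ofReal_integral_eq_lintegral_ofReal hg2
    (by filter_upwards with t; simp only [Pi.zero_apply]; positivity), avgProb]
  congr 1
  refine lintegral_congr fun t => ?_
  rw [inner_delta]
  congr 3
  ring

/-- The solution generated by the Laplace transform of the evolution of `δ₁`: a sequence on
`0, 1, 2, …` with value `i` at `0`. -/
noncomputable def laplaceSeq (V : ℕ+ → ℝ) (hV : ∃ C, ∀ n, |V n| ≤ C) (z : ℂ) : ℕ → ℂ
  | 0 => Complex.I
  | n + 1 => laplace (schrodinger V hV) (delta 1) z n.succPNat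

lemma laplaceSeq_recurrence (V : ℕ+ → ℝ) (hV : ∃ C, ∀ n, |V n| ≤ C) {z : ℂ} (hz : 0 < z.im)
    (k : ℕ) :
    laplaceSeq V hV z k =
      (z - V k.succPNat) * laplaceSeq V hV z (k + 1) - laplaceSeq V hV z (k + 2) := by
  have h := congrArg (fun φ : ell2 => φ k.succPNat)
    (apply_laplace (isSelfAdjoint_schrodinger V hV) (delta 1) hz)
  simp only [schrodinger_apply] at h
  set U := laplace (schrodinger V hV) (delta 1) z with hU
  have e1 : (k.succPNat : ℕ+) + 1 = (k + 1).succPNat := rfl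
  have e2 : ((k.succPNat : ℕ+) : ℕ) - 1 = k := rfl
  rw [e1, e2] at h
  simp only [lp.coeFn_sub, lp.coeFn_smul, Pi.sub_apply, Pi.smul_apply, smul_eq_mul] at h
  -- At site `1` the source term `-i δ₁` takes the place of the boundary value `i`; elsewhere it
  -- vanishes.
  cases k with
  | zero =>
    have hd : delta 1 (Nat.succPNat 0) = 1 := by
      have := lp.single_apply_self 2 (1 : ℕ+) (1 : ℂ) (E := fun _ : ℕ+ => ℂ)
      exact this
    rw [hd] at h
    simp only [laplaceSeq, dirichletExt, ← hU] at h ⊢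
    linear_combination h
  | succ k =>
    have hd : delta 1 (Nat.succPNat (k + 1)) = 0 := by
      refine lp.single_apply_ne (E := fun _ : ℕ+ => ℂ) 2 (1 : ℕ+) (1 : ℂ) ?_
      intro hc
      have := congrArg PNat.val hc
      simp at this
    rw [hd] at h
    simp only [laplaceSeq, dirichletExt, ← hU] at h ⊢
    linear_combination h

/-! ### From transfer matrix bounds to growth exponents -/

lemma le_lowerExponent {H : ell2 →L[ℂ] ell2} {ψ : ell2} {p c γ : ℝ} (hc : 0 < c)
    (h : ∀ᶠ T : ℝ in atTop, ENNReal.ofReal (c * T ^ γ) ≤ moment H ψ p T) :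
    (γ : EReal) ≤ lowerExponent H ψ p := by
  have hlim : Tendsto (fun T : ℝ => Real.log c / Real.log T + γ) atTop (𝓝 γ) := by
    simpa using (Real.tendsto_log_atTop.const_div_atTop (Real.log c)).add_const γ
  rw [← ((continuous_coe_real_ereal.tendsto γ).comp hlim).liminf_eq]
  refine liminf_le_liminf ?_
  filter_upwards [h, eventually_gt_atTop 1] with T hT hT1
  have hlog : 0 < Real.log T := Real.log_pos hT1
  have hT0 : 0 < T := by linarith
  have e : Real.log c / Real.log T + γ = Real.log (c * T ^ γ) / Real.log T := by
    rw [Real.log_mul hc.ne' (by positivity), Real.log_rpow hT0]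
    field_simp
  rw [Function.comp_apply, e, EReal.coe_div, ← ENNReal.log_ofReal_of_pos (by positivity)]
  exact EReal.div_le_div_right_of_nonneg (by exact_mod_cast hlog.le) (ENNReal.log_le_log hT)

/-- A lower bound for a sum over the sites by pairs of neighbouring sites. -/
lemma le_tsum_of_le_pairs {f : ℕ+ → ℝ≥0∞} {M : ℕ} {x : ℝ}
    (h : ∀ k, M ≤ k → k < 2 * M →
      ENNReal.ofReal (2 * x) ≤ f k.succPNat + f (k + 1).succPNat) :
    ENNReal.ofReal (M * x) ≤ ∑' n, f n := by
  have h1 : ∑' k : ℕ, f k.succPNat ≤ ∑' n, f n :=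
    ENNReal.tsum_comp_le_tsum_of_injective Nat.succPNat_injective f
  have h2 : ∑' k : ℕ, f (k + 1).succPNat ≤ ∑' n, f n :=
    ENNReal.tsum_comp_le_tsum_of_injective (f := fun k : ℕ => (k + 1).succPNat)
      (Nat.succPNat_injective.comp (add_left_injective 1)) f
  have h3 : ∑ k ∈ Finset.Ico M (2 * M), ENNReal.ofReal (2 * x)
      ≤ ∑' k : ℕ, (f k.succPNat + f (k + 1).succPNat) :=
    (Finset.sum_le_sum fun k hk => h k (Finset.mem_Ico.1 hk).1 (Finset.mem_Ico.1 hk).2).trans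
      (ENNReal.sum_le_tsum _)
  rw [ENNReal.tsum_add, Finset.sum_const, Nat.card_Ico, two_mul M, Nat.add_sub_cancel] at h3
  have h4 : 2 * ENNReal.ofReal (M * x) ≤ 2 * ∑' n, f n := by
    calc 2 * ENNReal.ofReal (M * x) = M • ENNReal.ofReal (2 * x) := by
          rw [ENNReal.ofReal_mul (by positivity), ENNReal.ofReal_mul (by positivity),
            ENNReal.ofReal_natCast, nsmul_eq_mul, ENNReal.ofReal_ofNat]
          ring
      _ ≤ _ := h3
      _ ≤ _ := by rw [two_mul]; exact add_le_add h1 h2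
  exact (ENNReal.mul_le_mul_iff_right two_ne_zero ENNReal.ofNat_ne_top).1 h4

/-- Polynomial transfer matrix bounds at a single energy bound the solution generated by the
time evolution from below, on a length scale adapted to `T`. -/
lemma norm_laplaceSeq_lower_bound {V : ℕ+ → ℝ} (hV : ∃ C, ∀ n, |V n| ≤ C) {E : ℝ}
    {α N : ℕ} {C : ℝ} (hC1 : 1 ≤ C)
    (hC : ∀ j ≥ N, ∀ m : ℕ,
      ‖stepProd (fun k => (E : ℂ) - V k.succPNat) j m‖ ≤ C * (1 + m) ^ α) :
    ∃ δ > 0, ∀ T ≥ (1 : ℝ), ∀ x : ℝ, x ^ (α + 1) = T → ∀ M : ℕ, 0 < M →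
      24 * C * M ≤ x → ∀ n, N ≤ n → n ≤ 2 * M →
      δ / x ^ α ≤ max ‖laplaceSeq V hV (E + (2 / T : ℝ) * Complex.I) (n + 1)‖
        ‖laplaceSeq V hV (E + (2 / T : ℝ) * Complex.I) n‖ := by
  obtain ⟨B, hB⟩ := id hV
  -- Bounds `1 + ‖c k + η‖` uniformly, as `‖η‖ = 2/T ≤ 2`.
  set D : ℝ := 3 + |E| + B with hD
  have hD0 : 0 < D := by have := (abs_nonneg _).trans (hB 1); positivity
  refine ⟨(2 * C * D ^ N)⁻¹, by positivity, fun T hT x hx M hM hMx n hn hn2 => ?_⟩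
  have hT0 : 0 < T := by linarith
  set z : ℂ := E + (2 / T : ℝ) * Complex.I with hz
  set η : ℂ := (2 / T : ℝ) * Complex.I with hη
  have hηn : ‖η‖ = 2 / T := by
    rw [hη, norm_mul, Complex.norm_real, Complex.norm_I, mul_one,
      Real.norm_of_nonneg (by positivity)]
  have hzim : 0 < z.im := by simp [hz, hη, hT0]
  set c : ℕ → ℂ := fun k => (E : ℂ) - V k.succPNat with hc
  set w : ℕ → ℂ × ℂ := fun k => (laplaceSeq V hV z (k + 1), laplaceSeq V hV z k) with hwdef
  have hw (k : ℕ) : w k = stepBack (c k + η) (w (k + 1)) := by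
    rw [stepBack_apply]
    refine Prod.ext rfl ?_
    change laplaceSeq V hV z k = _
    rw [laplaceSeq_recurrence V hV hzim k]
    simp only [hwdef, hc, hz]
    ring
  have hM1 : (1 : ℝ) ≤ M := by exact_mod_cast hM
  have hx24 : 24 * (M : ℝ) ≤ x := by nlinarith
  have hx0 : 0 < x := by linarith
  have hxα : 0 < x ^ α := by positivity
  have hstart : 1 ≤ D ^ N * ‖w N‖ := by
    refine le_trans ?_ (norm_zero_le_pow_mul hw (D := D) (fun k => ?_) N)
    · refine le_trans ?_ (norm_snd_le (w 0))
      simp [hwdef, laplaceSeq]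
    · have h1 : ‖c k + η‖ ≤ |E| + B + 2 := by
        refine (norm_add_le _ _).trans (add_le_add ((norm_sub_le _ _).trans ?_) ?_)
        · simp only [Complex.norm_real, Real.norm_eq_abs]
          gcongr
          exact hB _
        · rw [hηn, div_le_iff₀ hT0]; linarith
      rw [hD]; linarith
  have hK : ∀ j ≥ N, ∀ m, j + m ≤ n → ‖stepProd c j m‖ ≤ C * x ^ α := fun j hj m hm => by
    refine (hC j hj m).trans ?_
    gcongr
    have : (m : ℝ) ≤ 2 * M := by exact_mod_cast (by omega : m ≤ 2 * M)
    linarith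
  -- The scale `x ^ (α + 1) = T` is chosen for this: perturbation size `1/T`, times length `x`,
  -- times transfer bound `x ^ α`, stays bounded.
  have hpert : ‖η‖ * (n * (C * x ^ α)) ≤ 1 / 2 := by
    have hn' : (n : ℝ) ≤ 2 * M := by exact_mod_cast hn2
    have h1 : (n : ℝ) * (C * x ^ α) ≤ x / 12 * x ^ α := by
      calc (n : ℝ) * (C * x ^ α) ≤ 2 * M * (C * x ^ α) := by gcongr
        _ = 24 * C * M / 12 * x ^ α := by ring
        _ ≤ _ := by gcongr
    calc ‖η‖ * (n * (C * x ^ α)) ≤ 2 / T * (x / 12 * x ^ α) := by rw [hηn]; gcongr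
      _ = x ^ (α + 1) / T / 6 := by ring
      _ ≤ 1 / 2 := by rw [hx, div_self hT0.ne']; norm_num
  have hmain := norm_le_of_perturbation hw hn hK hpert
  have hfin : 1 ≤ (2 * C * D ^ N) * x ^ α * ‖w n‖ := by
    calc 1 ≤ D ^ N * ‖w N‖ := hstart
      _ ≤ D ^ N * (2 * (C * x ^ α) * ‖w n‖) := by gcongr
      _ = _ := by ring
  change _ ≤ ‖w n‖
  rw [inv_eq_one_div, div_div, div_le_iff₀ (by positivity)]
  linarith

/-- Polynomial transfer matrix bounds at a single energy imply power-law growth of the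
time-averaged moments. -/
theorem le_lowerExponent_of_norm_stepProd_le {V : ℕ+ → ℝ} (hV : ∃ C, ∀ n, |V n| ≤ C) {E : ℝ}
    {α N : ℕ} {C : ℝ}
    (hC : ∀ j ≥ N, ∀ m : ℕ,
      ‖stepProd (fun k => (E : ℂ) - V k.succPNat) j m‖ ≤ C * (1 + m) ^ α)
    {p : ℝ} (hp : 0 < p) :
    (((p - 1 - 4 * α) / (1 + α) : ℝ) : EReal) ≤
      lowerExponent (schrodinger V hV) (delta 1) p := by
  wlog hC1 : 1 ≤ C generalizing C
  · exact this (C := 1) (fun j hj m => (hC j hj m).trans (by gcongr; linarith)) le_rfl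
  obtain ⟨δ, hδ, hlow⟩ := norm_laplaceSeq_lower_bound hV hC1 hC
  set κ : ℝ := 1 / (24 * C) with hκ
  have hκ0 : 0 < κ := by positivity
  set r : ℝ := 1 / (1 + α) with hr
  have hr0 : 0 < r := by positivity
  refine le_lowerExponent (c := (κ / 2) ^ (p + 1) * δ ^ 2) (by positivity) ?_
  -- Ensures both that rounding down loses at most half of `κ * x` and that `M ≥ N + 1`.
  have hlarge : ∀ᶠ T : ℝ in atTop, 2 * (N + 1) ≤ κ * T ^ r :=
    ((tendsto_rpow_atTop hr0).const_mul_atTop hκ0).eventually_ge_atTop _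
  filter_upwards [hlarge, eventually_ge_atTop 1] with T hTN hT1
  have hT0 : 0 < T := by linarith
  set x : ℝ := T ^ r with hx
  have hx0 : 0 < x := by positivity
  have hxT : x ^ (α + 1) = T := by
    rw [hx, ← Real.rpow_natCast, ← Real.rpow_mul hT0.le, hr]
    push_cast
    rw [add_comm (1 : ℝ), one_div_mul_cancel (by positivity), Real.rpow_one]
  set M : ℕ := ⌊κ * x⌋₊ with hM
  have hMle : (M : ℝ) ≤ κ * x := Nat.floor_le (by positivity)
  have hMge : κ * x / 2 ≤ M := by
    have := Nat.lt_floor_add_one (κ * x)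
    have hN : (0 : ℝ) ≤ N := by positivity
    linarith
  have hMN : N + 1 ≤ M := by
    have : ((N + 1 : ℕ) : ℝ) ≤ M := by push_cast; linarith
    exact_mod_cast this
  have hM24 : 24 * C * M ≤ x := by
    calc 24 * C * M ≤ 24 * C * (κ * x) := by gcongr
      _ = x := by rw [hκ]; field_simp
  have hMpos : (0 : ℝ) < M := by exact_mod_cast (by omega : 0 < M)
  have hpair (k : ℕ) (hk1 : M ≤ k) (hk2 : k < 2 * M) :
      ENNReal.ofReal (2 * ((M : ℝ) ^ p * (1 / T ^ 2 * (δ / x ^ α) ^ 2))) ≤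
        ENNReal.ofReal (((k.succPNat : ℕ) : ℝ) ^ p) *
            avgProb (schrodinger V hV) (delta 1) k.succPNat T +
          ENNReal.ofReal ((((k + 1).succPNat : ℕ) : ℝ) ^ p) *
            avgProb (schrodinger V hV) (delta 1) (k + 1).succPNat T := by
    have hsite (l : ℕ) (hl : M ≤ l)
        (hu : δ / x ^ α ≤ ‖laplaceSeq V hV (E + (2 / T : ℝ) * Complex.I) (l + 1)‖) :
        ENNReal.ofReal (2 * ((M : ℝ) ^ p * (1 / T ^ 2 * (δ / x ^ α) ^ 2))) ≤
          ENNReal.ofReal (((l.succPNat : ℕ) : ℝ) ^ p) *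
            avgProb (schrodinger V hV) (delta 1) l.succPNat T := by
      calc _ = ENNReal.ofReal ((M : ℝ) ^ p) *
              ENNReal.ofReal (2 / T ^ 2 * (δ / x ^ α) ^ 2) := by
            rw [← ENNReal.ofReal_mul (by positivity)]; congr 1; ring
        _ ≤ ENNReal.ofReal (((l.succPNat : ℕ) : ℝ) ^ p) * ENNReal.ofReal (2 / T ^ 2 *
              ‖laplace (schrodinger V hV) (delta 1) (E + (2 / T : ℝ) * Complex.I)
                l.succPNat‖ ^ 2) := by
            gcongr
            · rw [Nat.succPNat_coe]; omega
            · exact hu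
        _ ≤ _ := by
            gcongr
            exact ofReal_laplace_le_avgProb (isSelfAdjoint_schrodinger V hV) _ _ hT0
    -- Index `k + 1` of the sequence involves its values at `k + 2` and `k + 1`, which are the sites
    -- `(k + 1).succPNat` and `k.succPNat`.
    rcases le_max_iff.1 (hlow T hT1 x hxT M (by omega) hM24 (k + 1) (by omega) (by omega))
      with h | h
    · exact (hsite (k + 1) (by omega) h).trans le_add_self
    · exact (hsite k hk1 h).trans le_self_add
  refine le_trans (ENNReal.ofReal_le_ofReal ?_) (le_tsum_of_le_pairs hpair)
  have hexp : T ^ ((p - 1 - 4 * (α : ℝ)) / (1 + α)) =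
      x ^ (p + 1) * (1 / T ^ 2 * (1 / x ^ α) ^ 2) := by
    have e1 : x ^ (p + 1) = T ^ (r * (p + 1)) := by rw [hx, ← Real.rpow_mul hT0.le]
    have e2 : (1 / x ^ α) ^ 2 = T ^ (-(2 * α * r)) := by
      rw [Real.rpow_neg hT0.le, one_div, inv_pow, ← pow_mul, hx, ← Real.rpow_natCast,
        ← Real.rpow_mul hT0.le]
      push_cast
      congr 2; ring
    have e3 : 1 / T ^ 2 = T ^ (-2 : ℝ) := by
      rw [Real.rpow_neg hT0.le, one_div, Real.rpow_two]
    rw [e1, e2, e3, ← Real.rpow_add hT0, ← Real.rpow_add hT0]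
    congr 1
    rw [hr]
    field_simp
    ring
  calc (κ / 2) ^ (p + 1) * δ ^ 2 * T ^ ((p - 1 - 4 * (α : ℝ)) / (1 + α))
      = (κ * x / 2) ^ (p + 1) * (1 / T ^ 2 * (δ / x ^ α) ^ 2) := by
        rw [hexp, show κ * x / 2 = κ / 2 * x by ring,
          Real.mul_rpow (by positivity) hx0.le]
        ring
    _ ≤ (M : ℝ) ^ (p + 1) * (1 / T ^ 2 * (δ / x ^ α) ^ 2) := by gcongr
    _ = M * ((M : ℝ) ^ p * (1 / T ^ 2 * (δ / x ^ α) ^ 2)) := by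
        rw [Real.rpow_add hMpos, Real.rpow_one]; ring

/-- Eventually even runs of the value `a` reduce the transfer matrices at energy `a` to powers of
the one-step matrix of the value `b`. -/
lemma norm_stepProd_le_of_eventuallyEvenRuns {a b : ℝ} {V : ℕ+ → ℝ}
    (hV : ∀ n, V n = a ∨ V n = b) (hS : EventuallyEvenRuns a b V) :
    ∃ N : ℕ, ∀ j ≥ N, ∀ m : ℕ, ∃ q ≤ m,
      ‖stepProd (fun k => (a : ℂ) - V k.succPNat) j m‖ ≤ ‖stepBack ((a - b : ℝ) : ℂ) ^ q‖ := by
  obtain ⟨N, hN⟩ := hS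
  refine ⟨N, fun j hj m => norm_stepProd_le_of_even_runs (fun n => ?_) ?_ hj m⟩
  · rcases hV n.succPNat with h | h <;> simp [h]
  · intro n hn k hk h1 h2 h3
    have hb (i : ℕ) (h : (a : ℂ) - V i.succPNat = ((a - b : ℝ) : ℂ)) : V i.succPNat = b := by
      have h' : a - V i.succPNat = a - b := by exact_mod_cast h
      linarith
    refine hN n.succPNat (by rw [← PNat.coe_le_coe, Nat.succPNat_coe]; omega) ⟨k, hk⟩
      (hb n h1) ?_ fun i hi => ?_
    · have e : n.succPNat + ⟨k, hk⟩ + 1 = (n + k + 1).succPNat :=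
        PNat.eq (show n + 1 + k + 1 = n + k + 1 + 1 by omega)
      rw [e, hb _ h2]
    · have hi' : (i : ℕ) ≤ k := hi
      have h4 : (a : ℂ) - V (n + i).succPNat = 0 := h3 i i.pos hi'
      have h5 : a - V (n + i).succPNat = 0 := by exact_mod_cast h4
      have e : n.succPNat + i = (n + i).succPNat := by
        apply PNat.eq
        simp; omega
      rw [e]; linarith

end HalfLine

theorem theorem4p2 (a b : ℝ) (V : ℕ+ → ℝ) (hV : ∀ n, V n = a ∨ V n = b)
    (hS3 : HalfLine.EventuallyEvenRuns a b V) :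
    (|a - b| < 2 → ∀ p : ℝ, 0 < p →
      ((p - 1 : ℝ) : EReal) ≤
        HalfLine.lowerExponent (HalfLine.schrodinger V (HalfLine.bounded_of_two_valued hV))
          (HalfLine.delta 1) p) ∧
    (|a - b| = 2 → ∀ p : ℝ, 0 < p →
      (((p - 5) / 2 : ℝ) : EReal) ≤
        HalfLine.lowerExponent (HalfLine.schrodinger V (HalfLine.bounded_of_two_valued hV))
          (HalfLine.delta 1) p) := by
  obtain ⟨N, hN⟩ := HalfLine.norm_stepProd_le_of_eventuallyEvenRuns hV hS3
  refine ⟨fun hab p hp => ?_, fun hab p hp => ?_⟩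
  · obtain ⟨C, hC⟩ := HalfLine.norm_stepBack_pow_le_of_elliptic hab
    have h := HalfLine.le_lowerExponent_of_norm_stepProd_le (α := 0) (N := N) (C := C) (E := a)
      (HalfLine.bounded_of_two_valued hV) (fun j hj m => ?_) hp
    · simpa using h
    · obtain ⟨q, -, hq⟩ := hN j hj m
      simpa using hq.trans (hC q)
  · obtain ⟨C, hC0, hC⟩ := HalfLine.norm_stepBack_pow_le_of_parabolic hab
    -- The constant `1 + C` comes from `1 + C * m ≤ (1 + C) * (1 + m)`.
    have h := HalfLine.le_lowerExponent_of_norm_stepProd_le (α := 1) (N := N) (C := 1 + C)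
      (E := a) (HalfLine.bounded_of_two_valued hV) (fun j hj m => ?_) hp
    · convert h using 2
      push_cast
      ring
    · obtain ⟨q, hqm, hq⟩ := hN j hj m
      refine hq.trans ((hC q).trans ?_)
      have hqm' : (q : ℝ) ≤ m := by exact_mod_cast hqm
      have h1 : C * q ≤ C * m := by gcongr
      rw [pow_one]
      nlinarith [Nat.cast_nonneg (α := ℝ) m]
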